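/- For $\ell\ge 3$ let $C_\ell$ denote the cycle with $\ell$ vertices, and let $\square$ denote the Cartesian product of graphs. For a finite simple graph $G=(V,E)$ let $F_G=\prod_{\{u,v\}\in E}(x_v-x_u)\in\mathbb{R}[x_v : v\in V]$ be its graph polynomial (defined up to sign). The Alon--Tarsi number $\mathrm{AT}(G)$ is the least $k$ such that some monomial $\prod_{v} x_v^{d_v}$ with $\max_v d_v=k-1$ has a non-zero coefficient in $F_G$. The list chromatic number $\mathrm{ch}(G)$ is the least $s$ such that, for every assignment to the vertices $v$ of finite lists $A_v\subset\mathbb{R}$ of colors with $|A_v|\ge s$, there is a proper coloring of $G$ in which each vertex $v$ gets a color from $A_v$. Let $m,n$ be integers with $0\le m<n$, and let $k_1,\dots,k_n$ be integers with $k_i\ge 1$ for $1\le i\le m$, $k_i\ge 2$ for $m<i\le n$, and $$\frac1{k_1}+\dots+\frac1{k_m}\le 1$$ (the sum is $0$ if $m=0$). Let $$G=C_{2k_1+1}\,\square\,\cdots\,\square\, C_{2k_m+1}\,\square\, C_{2k_{m+1}}\,\square\,\cdots\,\square\, C_{2k_n}.$$ Then $$\mathrm{ch}(G)\le \mathrm{AT}(G)=n+1.$$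 -/

import Mathlib

namespace SimpleGraph

/-- The Cartesian product of a family of graphs: two vertices are adjacent iff they agree in all
coordinates but one, and in that coordinate they are adjacent. -/
def cartesianProduct {ι : Type*} {V : ι → Type*} (G : ∀ i, SimpleGraph (V i)) :
    SimpleGraph (∀ i, V i) where
  Adj u v := ∃ i, (G i).Adj (u i) (v i) ∧ ∀ j, j ≠ i → u j = v j
  symm := ⟨fun _ _ ⟨i, hi, h⟩ => ⟨i, hi.symm, fun j hj => (h j hj).symm⟩⟩
  loopless := ⟨fun _ ⟨i, hi, _⟩ => (G i).irrefl hi⟩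

variable {V : Type*}

open Classical in
/-- The graph polynomial: the product over all edges `{u, v}` of the linear factors `x_v - x_u`.
It is defined up to a sign; the ordering of the two ends of each edge is fixed by choice. -/
noncomputable def graphPolynomial [Fintype V] (G : SimpleGraph V) : MvPolynomial V ℝ :=
  ∏ e ∈ G.edgeFinset, (MvPolynomial.X (Quot.out e).2 - MvPolynomial.X (Quot.out e).1)

/-- The Alon-Tarsi number: the least `k` such that some monomial `x ^ d` with `max d = k - 1` has
a non-zero coefficient in the graph polynomial. -/
noncomputable def alonTarsiNumber [Fintype V] (G : SimpleGraph V) : ℕ∞ :=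
  ⨅ k ∈ {k : ℕ | ∃ d : V →₀ ℕ, (Finset.univ.sup fun v => d v) + 1 = k ∧
    G.graphPolynomial.coeff d ≠ 0}, (k : ℕ∞)

/-- `G` is `m`-choosable: whenever every vertex has a list of at least `m` colours (real numbers),
there is a proper colouring of `G` that takes the colour of each vertex from its list. -/
def Choosable (G : SimpleGraph V) (m : ℕ) : Prop :=
  ∀ A : V → Finset ℝ, (∀ v, m ≤ (A v).card) → ∃ C : G.Coloring ℝ, ∀ v, C v ∈ A v

/-- The list chromatic number: the least `m` such that `G` is `m`-choosable. -/
noncomputable def listChromaticNumber (G : SimpleGraph V) : ℕ∞ :=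
  ⨅ m ∈ {m : ℕ | G.Choosable m}, (m : ℕ∞)

end SimpleGraph

/-! The coefficients of the graph polynomial are signed counts of choices of one end for each edge.
On an `n`-dimensional torus every vertex is `n` times a head and `n` times a tail, so a monomial has
average exponent `n`. This gives `AT ≥ n + 1`, with equality as soon as the central monomial `∏ x_v
^ n` has a non-zero coefficient. The bound for lists is the Alon-Tarsi theorem, via the
combinatorial Nullstellensatz.

An even cycle is split off by a transfer matrix `M` indexed by vertex sets of the remaining factor:
the central coefficient is `tr (M ^ N)` (`orientCoeff_cycle`). Reversing all choices shows that `M`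
is symmetric or antisymmetric, so for even `N` the trace is up to sign a sum of squares, and it
suffices that `M ≠ 0`. This says that the factor has a monomial with exponents in `{m - 1, m, m +
1}` (`AlmostCentral`). Induction on the number of even directions leaves a product of odd cycles.

There, an angle that grows by `1 / N j` modulo `1` along each edge in direction `j` defines an
explicit choice `halfTurnChoice`. Disjoint arcs of lengths `1 / N j` fit in half a turn, and
telescoping over them keeps the exponents almost central. Any choice with the same exponents differs
from it by a circulation, which three potentials show to have even total, so nothing cancels
(`choiceSign_eq_of_outDeg_eq`). -/

namespace AlonTarsi

open Finset

/-! ### Signed counts of orientations -/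

section Orientation

variable {E V : Type*} [Fintype E] [DecidableEq V]

/-- The number of edges that choose the vertex `v`, when every edge `e` chooses one of its two
ends `h e` (if `T e` is true) and `t e` (otherwise). -/
def outDeg (h t : E → V) (T : E → Bool) (v : V) : ℤ :=
  ∑ e, if (if T e then h e else t e) = v then 1 else 0

/-- The sign of a choice of ends: `-1` to the number of edges that choose their tail. -/
def choiceSign (T : E → Bool) : ℤ := ∏ e, if T e then 1 else -1

open Classical in
/-- The coefficient of `∏ x_v ^ d v` in `∏ (x_{h e} - x_{t e})`. -/
noncomputable def orientCoeff [DecidableEq E] (h t : E → V) (d : V → ℤ) : ℤ :=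
  ∑ T : E → Bool, if outDeg h t T = d then choiceSign T else 0

theorem choiceSign_sq (T : E → Bool) : choiceSign T * choiceSign T = 1 := by
  unfold choiceSign
  rw [← prod_mul_distrib]
  exact prod_eq_one fun e _ => by split <;> norm_num

theorem choiceSign_ne_zero (T : E → Bool) : choiceSign T ≠ 0 := fun h => by
  have := choiceSign_sq T
  simp [h] at this

theorem choiceSign_eq_neg_one_pow (T : E → Bool) :
    choiceSign T = (-1) ^ (∑ e, if T e then 0 else 1) := by
  unfold choiceSign
  rw [← prod_pow_eq_pow_sum]
  exact prod_congr rfl fun e _ => by by_cases h : T e <;> simp [h]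

theorem choiceSign_not (T : E → Bool) :
    choiceSign (fun e => !T e) = (-1) ^ Fintype.card E * choiceSign T := by
  unfold choiceSign
  rw [← card_univ, ← prod_const, ← prod_mul_distrib]
  refine prod_congr rfl fun e _ => ?_
  by_cases h : T e <;> simp [h]

/-- Every edge chooses exactly one of its ends, tested against a weight `φ`. -/
theorem sum_mul_outDeg [Fintype V] (h t : E → V) (T : E → Bool) (φ : V → ℤ) :
    ∑ v, φ v * outDeg h t T v = ∑ e, if T e then φ (h e) else φ (t e) := by
  unfold outDeg
  simp_rw [mul_sum]
  rw [sum_comm]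
  refine sum_congr rfl fun e _ => ?_
  simp only [mul_ite, mul_one, mul_zero, sum_ite_eq, mem_univ, if_true]
  split <;> rfl

theorem sum_outDeg [Fintype V] (h t : E → V) (T : E → Bool) :
    ∑ v, outDeg h t T v = Fintype.card E := by
  have := sum_mul_outDeg h t T 1
  simpa using this

theorem exists_of_orientCoeff_ne_zero [DecidableEq E] {h t : E → V} {d : V → ℤ} (hd : orientCoeff h t d ≠ 0) :
    ∃ T, outDeg h t T = d := by
  by_contra! H
  exact hd (sum_eq_zero fun T _ => if_neg (H T))

theorem sum_of_orientCoeff_ne_zero [DecidableEq E] [Fintype V] {h t : E → V} {d : V → ℤ}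
    (hd : orientCoeff h t d ≠ 0) : ∑ v, d v = Fintype.card E := by
  obtain ⟨T, rfl⟩ := exists_of_orientCoeff_ne_zero hd
  exact sum_outDeg h t T

/-- There is no cancellation if all choices with the same out-degrees have the same sign. -/
theorem orientCoeff_ne_zero_of_sign [DecidableEq E] {h t : E → V} (T₀ : E → Bool)
    (H : ∀ T, outDeg h t T = outDeg h t T₀ → choiceSign T = choiceSign T₀) :
    orientCoeff h t (outDeg h t T₀) ≠ 0 := by
  classical
  have : orientCoeff h t (outDeg h t T₀) = choiceSign T₀ *
      #{T : E → Bool | outDeg h t T = outDeg h t T₀} := by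
    unfold orientCoeff
    rw [card_filter, Nat.cast_sum, mul_sum]
    refine sum_congr rfl fun T _ => ?_
    by_cases hT : outDeg h t T = outDeg h t T₀
    · simp [hT, H T hT]
    · simp [hT]
  rw [this]
  refine mul_ne_zero (choiceSign_ne_zero _) ?_
  exact_mod_cast (card_pos.2 ⟨T₀, by simp⟩).ne'

theorem outDeg_comp {E' V' : Type*} [Fintype E'] [DecidableEq V'] (eE : E ≃ E') (eV : V ≃ V')
    {h t : E → V} {h' t' : E' → V'} (hh : ∀ e, h' (eE e) = eV (h e))
    (ht : ∀ e, t' (eE e) = eV (t e)) (T : E' → Bool) (v : V) :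
    outDeg h' t' T (eV v) = outDeg h t (T ∘ eE) v := by
  unfold outDeg
  rw [← eE.sum_comp]
  refine sum_congr rfl fun e _ => ?_
  rw [hh, ht, ← apply_ite eV]
  simp

/-- Isomorphic families of edges have the same coefficients. -/
theorem orientCoeff_congr [DecidableEq E] {E' V' : Type*} [Fintype E'] [DecidableEq E'] [DecidableEq V']
    (eE : E ≃ E') (eV : V ≃ V') {h t : E → V} {h' t' : E' → V'}
    (hh : ∀ e, h' (eE e) = eV (h e)) (ht : ∀ e, t' (eE e) = eV (t e)) (d : V' → ℤ) :
    orientCoeff h t (d ∘ eV) = orientCoeff h' t' d := by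
  unfold orientCoeff
  refine Fintype.sum_equiv (eE.arrowCongr (Equiv.refl Bool)) _ _ fun T => ?_
  have h1 : choiceSign (eE.arrowCongr (Equiv.refl Bool) T) = choiceSign T := by
    unfold choiceSign
    rw [← eE.prod_comp]
    simp
  have h2 : outDeg h' t' (eE.arrowCongr (Equiv.refl Bool) T) = d ↔ outDeg h t T = d ∘ eV := by
    rw [funext_iff, funext_iff, ← eV.forall_congr_right]
    refine forall_congr' fun v => ?_
    rw [outDeg_comp eE eV hh ht]
    have : (eE.arrowCongr (Equiv.refl Bool) T) ∘ eE = T := by ext; simp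
    rw [this]; rfl
  by_cases hT : outDeg h t T = d ∘ eV
  · rw [if_pos hT, if_pos (h2.2 hT), h1]
  · rw [if_neg hT, if_neg (h2.not.2 hT)]

/-- Every vertex is `m` times a head and `m` times a tail. -/
def IsBalanced (h t : E → V) (m : ℤ) : Prop :=
  ∀ v, (∑ e, if h e = v then (1 : ℤ) else 0) = m ∧ (∑ e, if t e = v then (1 : ℤ) else 0) = m

theorem IsBalanced.card_eq [Fintype V] {h t : E → V} {m : ℤ} (H : IsBalanced h t m) :
    (Fintype.card E : ℤ) = m * Fintype.card V := by
  rw [← sum_outDeg h t fun _ => true]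
  simp [outDeg, fun v => (H v).1, mul_comm]

theorem IsBalanced.outDeg_not {h t : E → V} {m : ℤ} (H : IsBalanced h t m) (T : E → Bool) (v : V) :
    outDeg h t (fun e => !T e) v = 2 * m - outDeg h t T v := by
  have : outDeg h t (fun e => !T e) v + outDeg h t T v =
      (∑ e, if h e = v then (1 : ℤ) else 0) + ∑ e, if t e = v then (1 : ℤ) else 0 := by
    simp only [outDeg, ← sum_add_distrib]
    refine sum_congr rfl fun e _ => ?_
    by_cases h : T e <;> simp [h, add_comm]
  rw [(H v).1, (H v).2] at this
  linarith

/-- Swapping the chosen end of every edge is a bijection that changes each sign by the same factor.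
-/
theorem IsBalanced.orientCoeff_symm [DecidableEq E] {h t : E → V} {m : ℤ} (H : IsBalanced h t m) (d : V → ℤ) :
    orientCoeff h t (fun v => 2 * m - d v) = (-1) ^ Fintype.card E * orientCoeff h t d := by
  unfold orientCoeff
  rw [mul_sum]
  refine (Fintype.sum_equiv ((Equiv.refl E).arrowCongr Equiv.boolNot) _ _ fun T => ?_).symm
  have h0 : (Equiv.refl E).arrowCongr Equiv.boolNot T = fun e => !T e := rfl
  have h2 : outDeg h t (fun e => !T e) = (fun v => 2 * m - d v) ↔ outDeg h t T = d := by
    rw [funext_iff, funext_iff]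
    refine forall_congr' fun v => ?_
    rw [H.outDeg_not]
    constructor <;> intro <;> linarith
  rw [h0]
  by_cases hT : outDeg h t T = d
  · rw [if_pos hT, if_pos (h2.2 hT), choiceSign_not]
  · rw [if_neg hT, if_neg (h2.not.2 hT), mul_zero]

end Orientation

/-! ### Closed walks and traces -/

section Trace

variable {σ : Type*} [Fintype σ]

/-- The closing factor `K` is arbitrary so that the induction can absorb the last step of the path
into it. -/
theorem sum_prod_path_mul [DecidableEq σ] (M : Matrix σ σ ℤ) (n : ℕ) (K : Matrix σ σ ℤ) :
    ∑ g : Fin (n + 1) → σ, (∏ s : Fin n, M (g s.castSucc) (g s.succ)) * K (g (Fin.last n)) (g 0) =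
      (M ^ n * K).trace := by
  induction n generalizing K with
  | zero =>
    rw [← (Equiv.funUnique (Fin 1) σ).symm.sum_comp]
    simp [Matrix.trace]
  | succ n ih =>
    rw [pow_succ, mul_assoc, ← ih (M * K), ← (Fin.snocEquiv fun _ => σ).sum_comp,
      Fintype.sum_prod_type_right]
    refine sum_congr rfl fun g _ => ?_
    rw [Matrix.mul_apply, mul_sum]
    refine sum_congr rfl fun b _ => ?_
    rw [Fin.prod_univ_castSucc]
    simp only [Fin.snocEquiv, Equiv.coe_fn_mk, Fin.snoc_castSucc, Fin.succ_last, Fin.snoc_last,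
      Fin.succ_castSucc]
    rw [← Fin.castSucc_zero, Fin.snoc_castSucc]
    ring

theorem sum_prod_finRotate [DecidableEq σ] (M : Matrix σ σ ℤ) {n : ℕ} (hn : n ≠ 0) :
    ∑ g : Fin n → σ, ∏ s, M (g s) (g (finRotate n s)) = (M ^ n).trace := by
  obtain ⟨n, rfl⟩ := Nat.exists_eq_succ_of_ne_zero hn
  rw [Nat.succ_eq_add_one, pow_succ, ← sum_prod_path_mul]
  refine sum_congr rfl fun g _ => ?_
  rw [Fin.prod_univ_castSucc]
  simp

theorem mul_transpose_ne_zero {M : Matrix σ σ ℤ} (hM : M ≠ 0) : (M * M.transpose).trace ≠ 0 := by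
  intro h
  apply hM
  simp only [Matrix.trace, Matrix.diag, Matrix.mul_apply, Matrix.transpose_apply] at h
  have hnn : ∀ i, 0 ≤ ∑ j, M i j * M i j := fun i => sum_nonneg fun j _ => mul_self_nonneg _
  ext i j
  have h1 := (sum_eq_zero_iff_of_nonneg fun i _ => hnn i).1 h i (mem_univ _)
  have h2 := (sum_eq_zero_iff_of_nonneg fun j _ => mul_self_nonneg (M i j)).1 h1 j (mem_univ _)
  simpa using h2

theorem trace_pow_ne_zero [DecidableEq σ] {M : Matrix σ σ ℤ} (hM : M ≠ 0) {ε : ℤ}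
    (hT : M.transpose = ε • M) (k : ℕ) : (M ^ (2 * k)).trace ≠ 0 := by
  have key : ∀ j, M ^ j ≠ 0 → (M ^ j * M ^ j).trace ≠ 0 := fun j hj h => by
    apply mul_transpose_ne_zero hj
    rw [Matrix.transpose_pow, hT, smul_pow, mul_smul_comm, Matrix.trace_smul, h, smul_zero]
  -- `M` is not nilpotent: by `key`, squaring never reaches zero, and `k ≤ 2 ^ k` then handles every
  -- power.
  have pow2 : ∀ j, M ^ (2 ^ j) ≠ 0 := fun j => by
    induction j with
    | zero => simpa
    | succ j ih =>
      intro h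
      apply key _ ih
      rw [← pow_add, ← mul_two, ← pow_succ, h, Matrix.trace_zero]
  rw [two_mul, pow_add]
  refine key k fun h => pow2 k ?_
  exact pow_eq_zero_of_le Nat.lt_two_pow_self.le h

end Trace

/-! ### Products with an even cycle -/

section Cycle

variable {E V : Type*} [Fintype E] [Fintype V]

/-- Heads of the edges of the product with the cycle of length `N`. -/
def cycleHead (h : E → V) (N : ℕ) : E × Fin N ⊕ V × Fin N → V × Fin N :=
  Sum.elim (fun p => (h p.1, p.2)) fun p => (p.1, finRotate N p.2)

/-- Tails of the edges of the product with the cycle of length `N`. -/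
def cycleTail (t : E → V) (N : ℕ) : E × Fin N ⊕ V × Fin N → V × Fin N :=
  Sum.elim (fun p => (t p.1, p.2)) id

/-- A choice of ends in the product, layer by layer. -/
def layerEquiv (E V : Type*) (N : ℕ) :
    (Fin N → V → Bool) × (Fin N → E → Bool) ≃ (E × Fin N ⊕ V × Fin N → Bool) where
  toFun p := Sum.elim (fun q => p.2 q.2 q.1) fun q => p.1 q.2 q.1
  invFun T := (fun s v => T (.inr (v, s)), fun s e => T (.inl (e, s)))
  left_inv _ := rfl
  right_inv T := by ext (_ | _) <;> rfl

/-- The indicator function of a set of vertices, with integer values. -/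
def ind (S : V → Bool) (v : V) : ℤ := if S v then 1 else 0

theorem choiceSign_layer {N : ℕ} (B : Fin N → V → Bool) (A : Fin N → E → Bool) :
    choiceSign (layerEquiv E V N (B, A)) = ∏ s, choiceSign (B s) * choiceSign (A s) := by
  simp only [choiceSign, Fintype.prod_sum_type, Fintype.prod_prod_type_right, prod_mul_distrib]
  rw [mul_comm]
  rfl

/-- A vertex is chosen by edges of its own layer, by the incoming cycle edge if that is in `B s`,
and by the outgoing one if that is not in the next set. Rotating the layer index avoids the inverse
rotation. -/
theorem outDeg_layer [DecidableEq V] {N : ℕ} (h t : E → V) (B : Fin N → V → Bool) (A : Fin N → E → Bool) (v : V)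
    (s : Fin N) : outDeg (cycleHead h N) (cycleTail t N) (layerEquiv E V N (B, A))
      (v, finRotate N s) =
      outDeg h t (A (finRotate N s)) v + 1 - ind (B (finRotate N s)) v + ind (B s) v := by
  have hE : ∀ r e, (if (if A r e then (h e, r) else (t e, r)) = (v, finRotate N s)
      then (1 : ℤ) else 0) =
      if r = finRotate N s then if (if A r e then h e else t e) = v then 1 else 0 else 0 :=
    fun r e => by
      rw [← apply_ite (fun w => (w, r)), ← ite_and]
      simp [Prod.ext_iff, and_comm]
  have hV : ∀ r w, (if (if B r w then (w, finRotate N r) else (w, r)) = (v, finRotate N s)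
      then (1 : ℤ) else 0) =
      (if w = v then if r = s then ind (B s) v else 0 else 0) +
      if w = v then if r = finRotate N s then 1 - ind (B (finRotate N s)) v else 0 else 0 :=
    fun r w => by
      by_cases hw : w = v
      · subst hw
        unfold ind
        by_cases h1 : r = s
        · subst h1
          by_cases h2 : r = finRotate N r
          · rw [← h2]; cases B r w <;> simp
          · cases hB : B r w <;> simp [h2, -finRotate_apply]
        · by_cases h2 : r = finRotate N s
          · subst h2
            cases hB : B (finRotate N s) w <;> simp [h1, -finRotate_apply]
          · cases hB : B r w <;> simp [h1, h2, -finRotate_apply]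
      · cases hB : B r w <;> simp [hw]
  have : outDeg (cycleHead h N) (cycleTail t N) (layerEquiv E V N (B, A)) (v, finRotate N s) =
      (∑ r, ∑ e, if (if A r e then (h e, r) else (t e, r)) = (v, finRotate N s)
        then (1 : ℤ) else 0) +
      ∑ r, ∑ w, if (if B r w then (w, finRotate N r) else (w, r)) = (v, finRotate N s)
        then (1 : ℤ) else 0 := by
    unfold outDeg
    rw [Fintype.sum_sum_type, Fintype.sum_prod_type_right, Fintype.sum_prod_type_right]
    rfl
  rw [this]
  simp_rw [hE, hV, sum_add_distrib]
  simp only [sum_ite_eq', mem_univ, if_true, sum_ite_irrel, sum_const_zero]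
  unfold outDeg
  ring

/-- Once the choices `B` on the edges between layers are fixed, the layers are independent, and the
layer after `s` sees only `B s` and its successor. Summing over `B` is summing over closed walks of
length `N`. -/
theorem orientCoeff_cycle [DecidableEq E] [DecidableEq V] {N : ℕ} (hN : N ≠ 0) (h t : E → V) (m : ℤ) :
    orientCoeff (cycleHead h N) (cycleTail t N) (fun _ => m + 1) =
      ((Matrix.of fun S R : V → Bool =>
        choiceSign S * orientCoeff h t fun v => m + ind R v - ind S v) ^ N).trace := by
  classical
  rw [← sum_prod_finRotate _ hN]
  conv_lhs => unfold orientCoeff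
  rw [← (layerEquiv E V N).sum_comp, Fintype.sum_prod_type]
  refine sum_congr rfl fun B _ => ?_
  simp only [Matrix.of_apply]
  rw [prod_mul_distrib]
  have h1 : ∏ s, orientCoeff h t (fun v => m + ind (B (finRotate N s)) v - ind (B s) v) =
      ∑ A : Fin N → E → Bool, ∏ s, if outDeg h t (A (finRotate N s)) =
        (fun v => m + ind (B (finRotate N s)) v - ind (B s) v) then
          choiceSign (A (finRotate N s)) else 0 := by
    unfold orientCoeff
    rw [Fintype.prod_sum]
    refine (Fintype.sum_equiv ((finRotate N).arrowCongr (Equiv.refl _)) _ _ fun A => ?_)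
    refine prod_congr rfl fun s _ => ?_
    rw [Equiv.arrowCongr_apply]
    simp only [Function.comp_apply, Equiv.symm_apply_apply, Equiv.refl_apply]
    congr
  rw [h1, mul_sum]
  refine sum_congr rfl fun A _ => ?_
  have h2 : outDeg (cycleHead h N) (cycleTail t N) (layerEquiv E V N (B, A)) = (fun _ => m + 1) ↔
      ∀ s, outDeg h t (A (finRotate N s)) =
        (fun v => m + ind (B (finRotate N s)) v - ind (B s) v) := by
    simp_rw [funext_iff]
    rw [Prod.forall, forall_comm, ← (finRotate N).forall_congr_right]
    refine forall_congr' fun s => forall_congr' fun v => ?_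
    rw [outDeg_layer]
    constructor <;> intro <;> linarith
  rw [choiceSign_layer]
  by_cases hT : ∀ s, outDeg h t (A (finRotate N s)) =
        (fun v => m + ind (B (finRotate N s)) v - ind (B s) v)
  · rw [if_pos (h2.2 hT), prod_mul_distrib]
    congr 1
    rw [← Equiv.prod_comp (finRotate N) fun s => choiceSign (A s)]
    exact prod_congr rfl fun s _ => (if_pos (hT s)).symm
  · rw [if_neg (h2.not.2 hT)]
    obtain ⟨s, hs⟩ := not_forall.1 hT
    exact (mul_eq_zero_of_right _ (prod_eq_zero (mem_univ s) (if_neg hs))).symm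

/-- Some monomial whose exponents differ from `m` by at most one has a non-zero coefficient. -/
def AlmostCentral [DecidableEq E] [DecidableEq V] (h t : E → V) (m : ℤ) : Prop :=
  ∃ d : V → ℤ, (∀ v, d v = m - 1 ∨ d v = m ∨ d v = m + 1) ∧ orientCoeff h t d ≠ 0

theorem choiceSign_eq_neg_one_pow_sum_ind (S : V → Bool) :
    choiceSign S = (-1) ^ Fintype.card V * (-1) ^ (∑ v, ind S v).natAbs := by
  have h : (∑ v, ind S v).natAbs = ∑ v, if S v then 1 else 0 := by
    have : (∑ v, ind S v) = ((∑ v, if S v then 1 else 0 : ℕ) : ℤ) := by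
      simp [ind]
    rw [this, Int.natAbs_natCast]
  rw [h, ← prod_pow_eq_pow_sum, ← card_univ, ← prod_const, ← prod_mul_distrib]
  unfold choiceSign
  exact prod_congr rfl fun e _ => by split <;> simp

/-- The product of a balanced family that has an almost central monomial with an even cycle has
the central monomial. -/
theorem AlmostCentral.orientCoeff_cycle_ne_zero [DecidableEq E] [DecidableEq V] {h t : E → V} {m : ℤ} (hb : IsBalanced h t m)
    (H : AlmostCentral h t m) {N : ℕ} (hN : N ≠ 0) (heven : Even N) :
    orientCoeff (cycleHead h N) (cycleTail t N) (fun _ => m + 1) ≠ 0 := by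
  obtain ⟨k, rfl⟩ := heven.two_dvd
  rw [orientCoeff_cycle hN]
  refine trace_pow_ne_zero ?_ (ε := (-1) ^ Fintype.card E) ?_ k
  · obtain ⟨d, hd, hne⟩ := H
    intro h0
    -- With these two sets, `m + ind R - ind S` is exactly `d`.
    have := congr_fun (congr_fun h0 fun v => decide (d v = m - 1)) fun v => decide (d v = m + 1)
    simp only [Matrix.of_apply, Matrix.zero_apply, mul_eq_zero, choiceSign_ne_zero, false_or]
      at this
    apply hne
    rw [← this]
    congr 1
    ext v
    unfold ind
    rcases hd v with h | h | h <;> simp [h] <;> omega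
  · ext S R
    simp only [Matrix.transpose_apply, Matrix.of_apply, Matrix.smul_apply, smul_eq_mul]
    have h1 : orientCoeff h t (fun v => m + ind S v - ind R v) =
        (-1) ^ Fintype.card E * orientCoeff h t fun v => m + ind R v - ind S v := by
      rw [← hb.orientCoeff_symm]
      congr 1
      ext v
      ring
    rw [h1]
    by_cases h0 : orientCoeff h t (fun v => m + ind R v - ind S v) = 0
    · simp [h0]
    -- Counting degrees, a non-zero entry forces `R` and `S` to have equal size, hence equal signs.
    · have h2 := sum_of_orientCoeff_ne_zero h0
      rw [hb.card_eq, sum_sub_distrib, sum_add_distrib] at h2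
      simp only [sum_const, card_univ, nsmul_eq_mul] at h2
      have h3 : ∑ v, ind R v = ∑ v, ind S v := by linarith
      rw [choiceSign_eq_neg_one_pow_sum_ind R, choiceSign_eq_neg_one_pow_sum_ind S, h3]
      ring

end Cycle

/-! ### The torus -/

section Torus

variable {ι : Type*} [DecidableEq ι] (N : ι → ℕ)

/-- The step in the direction `j` on a product of cycles. -/
def shift (j : ι) : Equiv.Perm (∀ i, Fin (N i)) where
  toFun v := Function.update v j (finRotate _ (v j))
  invFun v := Function.update v j ((finRotate _).symm (v j))
  left_inv v := by simp [-finRotate_apply, -finRotate_symm_apply]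
  right_inv v := by simp [-finRotate_apply, -finRotate_symm_apply]

theorem shift_apply (j : ι) (v : ∀ i, Fin (N i)) :
    shift N j v = Function.update v j (finRotate _ (v j)) := rfl

/-- Heads of the edges of a product of cycles. -/
def torusHead (p : ι × ∀ i, Fin (N i)) : ∀ i, Fin (N i) := shift N p.1 p.2

/-- Tails of the edges of a product of cycles. -/
def torusTail (p : ι × ∀ i, Fin (N i)) : ∀ i, Fin (N i) := p.2

theorem isBalanced_torus [Fintype ι] :
    IsBalanced (torusHead N) (torusTail N) (Fintype.card ι) := by
  intro v
  rw [Fintype.sum_prod_type, Fintype.sum_prod_type]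
  constructor
  · simp only [torusHead]
    simp_rw [← Equiv.eq_symm_apply]
    simp
  · have (j : ι) (u : ∀ i, Fin (N i)) : torusTail N (j, u) = u := rfl
    simp_rw [this]
    simp

/-- Splitting off the coordinate `i`. -/
def splitVertex (i : ι) : (∀ j : {j // j ≠ i}, Fin (N j)) × Fin (N i) ≃ ∀ j, Fin (N j) :=
  (Equiv.prodComm _ _).trans (Equiv.piSplitAt i fun j => Fin (N j)).symm

theorem splitVertex_self (i : ι) (w : ∀ j : {j // j ≠ i}, Fin (N j)) (s : Fin (N i)) :
    splitVertex N i (w, s) i = s := by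
  simp [splitVertex, Equiv.piSplitAt]

theorem splitVertex_of_ne (i : ι) (w : ∀ j : {j // j ≠ i}, Fin (N j)) (s : Fin (N i))
    (j : {j // j ≠ i}) : splitVertex N i (w, s) j = w j := by
  simp [splitVertex, Equiv.piSplitAt, j.2]

theorem shift_splitVertex_self (i : ι) (q : (∀ j : {j // j ≠ i}, Fin (N j)) × Fin (N i)) :
    shift N i (splitVertex N i q) = splitVertex N i (q.1, finRotate _ q.2) := by
  obtain ⟨w, s⟩ := q
  ext k : 1
  by_cases hk : k = i
  · subst hk
    rw [shift_apply, Function.update_self, splitVertex_self, splitVertex_self]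
  · rw [shift_apply, Function.update_of_ne hk]
    exact (splitVertex_of_ne N i w s ⟨k, hk⟩).trans (splitVertex_of_ne N i w _ ⟨k, hk⟩).symm

theorem shift_splitVertex_of_ne (i : ι) (j : {j // j ≠ i})
    (q : (∀ j : {j // j ≠ i}, Fin (N j)) × Fin (N i)) :
    shift N j (splitVertex N i q) = splitVertex N i (shift (fun k : {j // j ≠ i} => N k) j q.1, q.2) := by
  obtain ⟨w, s⟩ := q
  ext k : 1
  by_cases hk : k = i
  · subst hk
    rw [shift_apply, Function.update_of_ne j.2.symm, splitVertex_self, splitVertex_self]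
  · lift k to {j // j ≠ i} using hk
    rw [splitVertex_of_ne]
    by_cases hj : k = j
    · subst hj
      rw [shift_apply, Function.update_self, splitVertex_of_ne, shift_apply, Function.update_self]
    · rw [shift_apply, Function.update_of_ne (Subtype.coe_injective.ne hj), splitVertex_of_ne,
        shift_apply, Function.update_of_ne hj]

/-- Splitting the edges into those in the direction `i` and the others. -/
noncomputable def splitEdge (i : ι) :
    ({j // j ≠ i} × ∀ j : {j // j ≠ i}, Fin (N j)) × Fin (N i) ⊕
      (∀ j : {j // j ≠ i}, Fin (N j)) × Fin (N i) ≃ ι × ∀ j, Fin (N j) :=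
  Equiv.ofBijective
    (Sum.elim (fun p => (↑p.1.1, splitVertex N i (p.1.2, p.2))) fun q => (i, splitVertex N i q)) <| by
    constructor
    · rintro (⟨⟨j, w⟩, s⟩ | q) (⟨⟨j', w'⟩, s'⟩ | q') h
      · simp only [Sum.elim_inl, Prod.mk.injEq, EmbeddingLike.apply_eq_iff_eq] at h
        obtain ⟨h1, h2, h3⟩ := h
        rw [Subtype.ext h1, h2, h3]
      · exact absurd (congr_arg Prod.fst h) j.2
      · exact absurd (congr_arg Prod.fst h).symm j'.2
      · simpa using h
    · rintro ⟨j, v⟩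
      obtain ⟨q, rfl⟩ := (splitVertex N i).surjective v
      by_cases hj : j = i
      · exact ⟨.inr q, by simp [hj]⟩
      · exact ⟨.inl ((⟨j, hj⟩, q.1), q.2), rfl⟩

variable [Fintype ι]

theorem orientCoeff_torus_of_even {i : ι} (hi : Even (N i)) (h0 : N i ≠ 0)
    (H : AlmostCentral (torusHead fun j : {j // j ≠ i} => N j)
      (torusTail fun j : {j // j ≠ i} => N j) (Fintype.card {j // j ≠ i})) :
    orientCoeff (torusHead N) (torusTail N) (fun _ => (Fintype.card ι : ℤ)) ≠ 0 := by
  have h := H.orientCoeff_cycle_ne_zero (isBalanced_torus _) h0 hi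
  have : DecidableEq (∀ j : {j // j ≠ i}, Fin (N j)) := inferInstance
  rw [← orientCoeff_congr (splitEdge N i) (splitVertex N i)
    (h := cycleHead (torusHead fun j : {j // j ≠ i} => N j) (N i))
    (t := cycleTail (torusTail fun j : {j // j ≠ i} => N j) (N i))]
  · convert h using 3
    have : Fintype.card ι = Fintype.card {j // j ≠ i} + 1 := by
      rw [← Fintype.card_option, Fintype.card_congr (Equiv.optionSubtypeNe i)]
    rw [this]
    push_cast
    rfl
  · rintro (⟨⟨j, w⟩, s⟩ | q)
    · exact shift_splitVertex_of_ne N i j (w, s)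
    · exact shift_splitVertex_self N i q
  · rintro (⟨⟨j, w⟩, s⟩ | q) <;> rfl

end Torus

/-! ### Products of odd cycles -/

/-- Starting points of consecutive intervals of the lengths `s j`. -/
theorem exists_consecutive {ι : Type*} (s : ι → ℝ) (hs : ∀ j, 0 ≤ s j) (J : Finset ι) :
    ∃ α : ι → ℝ, (∀ j ∈ J, 0 ≤ α j ∧ α j + s j ≤ ∑ i ∈ J, s i) ∧
      ∀ F : ℝ → ℤ, ∑ j ∈ J, (F (α j + s j) - F (α j)) = F (∑ i ∈ J, s i) - F 0 := by
  classical
  induction J using Finset.induction_on with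
  | empty => exact ⟨0, by simp⟩
  | insert a J ha ih =>
    obtain ⟨α, h1, h2⟩ := ih
    have hne : ∀ j ∈ J, j ≠ a := fun j hj h => ha (h ▸ hj)
    refine ⟨Function.update α a (∑ i ∈ J, s i), fun j hj => ?_, fun F => ?_⟩
    · rw [sum_insert ha]
      rcases mem_insert.1 hj with rfl | hj
      · rw [Function.update_self]
        exact ⟨sum_nonneg fun i _ => hs i, (add_comm _ _).le⟩
      · rw [Function.update_of_ne (hne j hj)]
        exact ⟨(h1 j hj).1, by linarith [(h1 j hj).2, hs a]⟩
    · rw [sum_insert ha, sum_insert ha, Function.update_self]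
      have : ∑ j ∈ J, (F (Function.update α a (∑ i ∈ J, s i) j + s j) -
          F (Function.update α a (∑ i ∈ J, s i) j)) = F (∑ i ∈ J, s i) - F 0 := by
        rw [← h2 F]
        exact sum_congr rfl fun j hj => by rw [Function.update_of_ne (hne j hj)]
      rw [this, add_comm (s a)]
      ring

section OddTorus

variable {ι : Type*} [DecidableEq ι] (N : ι → ℕ)

/-- The angle of a vertex, in full turns: one round along any of the cycles is one turn. -/
noncomputable def angle [Fintype ι] (v : ∀ i, Fin (N i)) : ℝ := ∑ i, (v i : ℝ) / N i

/-- The indicator of the edges that close a cycle. -/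
def wrap (e : ι × ∀ i, Fin (N i)) : ℤ := if (e.2 e.1 : ℕ) + 1 = N e.1 then 1 else 0

theorem val_finRotate {n : ℕ} (x : Fin n) :
    ((finRotate n x : ℕ) : ℤ) = x + 1 - n * if (x : ℕ) + 1 = n then 1 else 0 := by
  obtain _ | n := n
  · exact x.elim0
  · rw [coe_finRotate]
    simp only [Fin.ext_iff, Fin.val_last, Nat.add_right_cancel_iff]
    split <;> simp [*]

theorem val_shift (e : ι × ∀ i, Fin (N i)) :
    ((torusHead N e e.1 : ℕ) : ℤ) = e.2 e.1 + 1 - N e.1 * wrap N e := by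
  rw [torusHead, shift_apply, Function.update_self, val_finRotate]
  rfl

theorem torusHead_of_ne (e : ι × ∀ i, Fin (N i)) {i : ι} (hi : i ≠ e.1) :
    torusHead N e i = e.2 i := by
  rw [torusHead, shift_apply, Function.update_of_ne hi]

variable {N} [Fintype ι]

theorem angle_torusHead (hN : ∀ i, N i ≠ 0) (e : ι × ∀ i, Fin (N i)) :
    angle N (torusHead N e) = angle N e.2 + 1 / N e.1 - wrap N e := by
  unfold angle
  rw [← add_sum_erase _ _ (mem_univ e.1), ← add_sum_erase univ _ (mem_univ e.1),
    sum_congr rfl fun i hi => by rw [torusHead_of_ne N e (ne_of_mem_erase hi)]]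
  have h : ((torusHead N e e.1 : ℕ) : ℝ) = e.2 e.1 + 1 - N e.1 * wrap N e := by
    exact_mod_cast val_shift N e
  rw [h]
  have : (N e.1 : ℝ) ≠ 0 := by exact_mod_cast hN _
  field_simp
  ring

theorem sum_val_torusHead (e : ι × ∀ i, Fin (N i)) :
    ∑ i, ((torusHead N e i : ℕ) : ℤ) = ∑ i, ((e.2 i : ℕ) : ℤ) + 1 - N e.1 * wrap N e := by
  rw [← add_sum_erase _ _ (mem_univ e.1),
    ← add_sum_erase univ (fun i => ((e.2 i : ℕ) : ℤ)) (mem_univ e.1),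
    sum_congr rfl fun i hi => by rw [torusHead_of_ne N e (ne_of_mem_erase hi)], val_shift]
  ring

variable (N)

/-- The choice of the heads of exactly those edges in the direction `j` that start in an odd half
turn counted from `α j`. -/
noncomputable def halfTurnChoice (α : ι → ℝ) (e : ι × ∀ i, Fin (N i)) : Bool :=
  decide (Odd ⌊2 * (angle N e.2 - α e.1)⌋)

variable {N}

theorem outDeg_halfTurnChoice (hN : ∀ i, N i ≠ 0) (α : ι → ℝ) (v : ∀ i, Fin (N i)) :
    outDeg (torusHead N) (torusTail N) (halfTurnChoice N α) v = Fintype.card ι +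
      ∑ j, ((if Odd ⌊2 * (angle N v - (α j + 1 / N j))⌋ then (1 : ℤ) else 0) -
        if Odd ⌊2 * (angle N v - α j)⌋ then 1 else 0) := by
  unfold outDeg
  rw [Fintype.sum_prod_type, Fintype.card_eq_sum_ones]
  push_cast
  rw [← sum_add_distrib]
  refine sum_congr rfl fun j _ => ?_
  have h1 : ∀ u, (if (if halfTurnChoice N α (j, u) then torusHead N (j, u) else
        torusTail N (j, u)) = v then (1 : ℤ) else 0) =
      (if u = (shift N j).symm v then if halfTurnChoice N α (j, u) then 1 else 0 else 0) +
      if u = v then if halfTurnChoice N α (j, u) then 0 else 1 else 0 := fun u => by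
    have hh : torusHead N (j, u) = v ↔ u = (shift N j).symm v := Equiv.eq_symm_apply _ |>.symm
    by_cases hT : halfTurnChoice N α (j, u)
    · simp only [hT, if_true, hh]
      simp
    · simp only [hT]
      simp [torusTail]
  simp_rw [h1, sum_add_distrib]
  rw [sum_ite_eq' univ, sum_ite_eq' univ, if_pos (mem_univ _), if_pos (mem_univ _)]
  have h2 := angle_torusHead hN (j, (shift N j).symm v)
  rw [torusHead, Equiv.apply_symm_apply] at h2
  -- Closing a cycle changes the number of half turns by two, which parity ignores.
  have h3 : 2 * (angle N ((shift N j).symm v) - α j) = 2 * (angle N v - (α j + 1 / N j)) +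
      ((2 * wrap N (j, (shift N j).symm v) : ℤ) : ℝ) := by
    push_cast
    rw [h2]
    ring
  simp only [halfTurnChoice, decide_eq_true_eq, h3, Int.floor_add_intCast, Int.odd_add,
    even_two_mul, iff_true]
  by_cases h4 : Odd ⌊2 * (angle N v - α j)⌋ <;> simp [h4, add_comm]

/-- Along an edge the number of half turns grows by zero or one, up to closing the cycle; if it
grows, then the start of the edge is in the same half turn relative to `a` as relative to `0`. -/
theorem exists_crossing (h3 : ∀ i, 3 ≤ N i) (e : ι × ∀ i, Fin (N i)) {a : ℝ} (ha : 0 ≤ a)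
    (ha' : 2 * (a + 1 / N e.1) ≤ 1) :
    ∃ c : ℤ, (c = 0 ∨ c = 1 ∧ ⌊2 * (angle N e.2 - a)⌋ = ⌊2 * angle N e.2⌋) ∧
      ⌊2 * angle N (torusHead N e)⌋ = ⌊2 * angle N e.2⌋ + c - 2 * wrap N e := by
  have hpos : (0 : ℝ) < 1 / N e.1 := by
    have := h3 e.1
    positivity
  have hlt : 2 * (1 / N e.1 : ℝ) < 1 := by
    have : (3 : ℝ) ≤ N e.1 := by exact_mod_cast h3 e.1
    rw [mul_one_div, div_lt_one (by linarith)]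
    linarith
  rw [angle_torusHead (fun i => by have := h3 i; omega)]
  have h1 : 2 * (angle N e.2 + 1 / N e.1 - wrap N e) = 2 * angle N e.2 + 2 * (1 / N e.1) -
      ((2 * wrap N e : ℤ) : ℝ) := by
    push_cast
    ring
  rw [h1, Int.floor_sub_intCast]
  set f := ⌊2 * angle N e.2⌋ with hf
  have hf1 : (f : ℝ) ≤ 2 * angle N e.2 := Int.floor_le _
  have hf2 : 2 * angle N e.2 < f + 1 := Int.lt_floor_add_one _
  by_cases hc : 2 * angle N e.2 + 2 * (1 / N e.1) < f + 1
  · refine ⟨0, Or.inl rfl, ?_⟩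
    rw [(Int.floor_eq_iff (z := f)).2 ⟨by linarith, hc⟩, add_zero]
  · push Not at hc
    refine ⟨1, Or.inr ⟨rfl, ?_⟩, ?_⟩
    · rw [Int.floor_eq_iff]
      -- A crossing edge starts within `2 / N` below `f + 1`, and `2 * (a + 1 / N) ≤ 1` keeps the
      -- start at or above `f` after subtracting `2 * a`.
      constructor <;> linarith
    · rw [(Int.floor_eq_iff (z := f + 1)).2]
      push_cast
      constructor <;> linarith

/-- All choices with the same out-degrees as `halfTurnChoice` have the same sign. -/
theorem choiceSign_eq_of_outDeg_eq (h3 : ∀ i, 3 ≤ N i) (hodd : ∀ i, Odd (N i)) {α : ι → ℝ}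
    (hα : ∀ i, 0 ≤ α i) (hα' : ∀ i, 2 * (α i + 1 / N i) ≤ 1) {T : (ι × ∀ i, Fin (N i)) → Bool}
    (hT : outDeg (torusHead N) (torusTail N) T =
      outDeg (torusHead N) (torusTail N) (halfTurnChoice N α)) :
    choiceSign T = choiceSign (halfTurnChoice N α) := by
  set T₀ := halfTurnChoice N α with hT₀
  set g : (ι × ∀ i, Fin (N i)) → ℤ := fun e => ind T e - ind T₀ e with hg
  -- Equal out-degrees make `g` a circulation, orthogonal to every potential difference.
  have pot : ∀ φ : (∀ i, Fin (N i)) → ℤ, ∑ e, g e * (φ (torusHead N e) - φ e.2) = 0 := by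
    intro φ
    have h1 := sum_mul_outDeg (torusHead N) (torusTail N) T φ
    rw [hT, sum_mul_outDeg, ← sub_eq_zero, ← sum_sub_distrib] at h1
    rw [← neg_eq_zero, ← sum_neg_distrib, ← h1]
    refine sum_congr rfl fun e _ => ?_
    simp only [hg, ind, torusTail]
    cases T e <;> cases T₀ e <;> simp
  choose c hc1 hc2 using fun e : ι × ∀ i, Fin (N i) => exists_crossing h3 e (hα e.1) (hα' e.1)
  -- `T₀` is extremal: on each edge crossing a half turn it picks the end in an even half turn.
  -- Against the indicator of even half turns all terms have one sign, so each of them vanishes.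
  have hgc : ∀ e, g e * c e = 0 := by
    have h1 := pot fun v => if Odd ⌊2 * angle N v⌋ then 0 else 1
    have h2 : ∀ e, g e * ((if Odd ⌊2 * angle N (torusHead N e)⌋ then 0 else 1) -
        if Odd ⌊2 * angle N e.2⌋ then 0 else 1) = - |g e * c e| := by
      intro e
      rw [hc2]
      rcases hc1 e with h | ⟨h, h'⟩
      · simp [h, Int.odd_sub]
      · have h4 : T₀ e = true ↔ Odd ⌊2 * angle N e.2⌋ := by
          rw [hT₀, halfTurnChoice, decide_eq_true_eq, h']
        have h5 : Odd (⌊2 * angle N e.2⌋ + 1 - 2 * wrap N e) ↔ ¬ Odd ⌊2 * angle N e.2⌋ := by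
          simp [Int.odd_sub]
        rw [h]
        simp only [h5, ← h4, hg, ind, mul_one]
        cases T e <;> cases T₀ e <;> simp
    simp_rw [h2] at h1
    rw [sum_neg_distrib, neg_eq_zero, sum_eq_zero_iff_of_nonneg fun _ _ => abs_nonneg _] at h1
    exact fun e => abs_eq_zero.1 (h1 e (mem_univ e))
  -- Without crossings, only the closing edges contribute to the potential counting half turns.
  have hgw : ∑ e, g e * wrap N e = 0 := by
    have h1 := pot fun v => ⌊2 * angle N v⌋
    have h2 : ∀ e, g e * (⌊2 * angle N (torusHead N e)⌋ - ⌊2 * angle N e.2⌋) =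
        -2 * (g e * wrap N e) := fun e => by
      rw [hc2]
      linear_combination hgc e
    simp_rw [h2] at h1
    rw [← mul_sum] at h1
    linarith
  -- Against the coordinate sum, `∑ g = ∑ g * N * wrap`. As the lengths are odd, this is congruent
  -- to `∑ g * wrap = 0` modulo `2`.
  have heven : Even (∑ e, g e) := by
    choose k hk using hodd
    have h1 := pot fun v => ∑ i, ((v i : ℕ) : ℤ)
    have h2 : ∀ e, g e * (∑ i, ((torusHead N e i : ℕ) : ℤ) - ∑ i, ((e.2 i : ℕ) : ℤ)) =
        g e - g e * wrap N e - 2 * (g e * wrap N e * k e.1) := fun e => by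
      have h4 : (N e.1 : ℤ) = 2 * k e.1 + 1 := by exact_mod_cast hk e.1
      rw [sum_val_torusHead, h4]
      ring
    simp_rw [h2] at h1
    rw [sum_sub_distrib, sum_sub_distrib, hgw, ← mul_sum] at h1
    exact ⟨∑ e, g e * wrap N e * k e.1, by linarith⟩
  rw [choiceSign_eq_neg_one_pow, choiceSign_eq_neg_one_pow]
  refine neg_one_pow_congr ?_
  rw [← Int.even_coe_nat, ← Int.even_coe_nat, ← Int.even_sub, ← even_neg]
  convert! heven
  push_cast
  rw [neg_sub, ← sum_sub_distrib]
  refine sum_congr rfl fun e _ => ?_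
  simp only [hg, ind]
  cases T e <;> cases T₀ e <;> simp

theorem almostCentral_torus_of_odd (h3 : ∀ i, 3 ≤ N i) (hodd : ∀ i, Odd (N i))
    (hsum : ∑ i, 2 / (N i : ℝ) ≤ 1) :
    AlmostCentral (torusHead N) (torusTail N) (Fintype.card ι) := by
  obtain ⟨α, h1, h2⟩ := exists_consecutive (fun i => 1 / (N i : ℝ)) (fun i => by positivity) univ
  have hα : ∀ i, 0 ≤ α i := fun i => (h1 i (mem_univ i)).1
  have hα' : ∀ i, 2 * (α i + 1 / N i) ≤ 1 := fun i => by
    have := (h1 i (mem_univ i)).2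
    have h4 : ∑ i, 2 / (N i : ℝ) = 2 * ∑ i, 1 / (N i : ℝ) := by
      rw [mul_sum]
      simp
      rfl
    linarith
  refine ⟨_, fun v => ?_, orientCoeff_ne_zero_of_sign (halfTurnChoice N α) fun T hT =>
    choiceSign_eq_of_outDeg_eq h3 hodd hα hα' hT⟩
  -- The sum telescopes to a difference of two indicators, hence lies in `{-1, 0, 1}`.
  rw [outDeg_halfTurnChoice (fun i => by have := h3 i; omega),
    h2 fun a => if Odd ⌊2 * (angle N v - a)⌋ then (1 : ℤ) else 0]
  split <;> split <;> omega

end OddTorus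

/-- A product of cycles whose odd lengths `N i` satisfy `∑ 2 / N i ≤ 1` has an almost central
monomial, and has the central monomial if some length is even. -/
theorem almostCentral_torus {ι : Type*} [DecidableEq ι] [Fintype ι] (N : ι → ℕ)
    (h3 : ∀ i, 3 ≤ N i) (hsum : ∑ i with Odd (N i), 2 / (N i : ℝ) ≤ 1) :
    AlmostCentral (torusHead N) (torusTail N) (Fintype.card ι) ∧ ∀ i, Even (N i) →
      orientCoeff (torusHead N) (torusTail N) (fun _ => (Fintype.card ι : ℤ)) ≠ 0 := by
  induction hn : Fintype.card ι generalizing ι with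
  | zero =>
    have := Fintype.card_eq_zero_iff.1 hn
    rw [← hn]
    exact ⟨almostCentral_torus_of_odd h3 isEmptyElim (by simp), isEmptyElim⟩
  | succ n ih =>
    rw [← hn]
    -- Deleting an even direction does not change the sum over odd lengths, so induction applies to
    -- the rest.
    have central : ∀ i, Even (N i) →
        orientCoeff (torusHead N) (torusTail N) (fun _ => (Fintype.card ι : ℤ)) ≠ 0 := by
      intro i hi
      have hcard : Fintype.card {j // j ≠ i} = n := by
        have : Fintype.card ι = Fintype.card {j // j ≠ i} + 1 := by
          rw [← Fintype.card_option, Fintype.card_congr (Equiv.optionSubtypeNe i)]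
        omega
      refine orientCoeff_torus_of_even N hi (by have := h3 i; omega) ?_
      rw [hcard]
      refine (ih (fun j : {j // j ≠ i} => N j) (fun j => h3 j) ?_ hcard).1
      refine le_trans (le_of_eq ?_) hsum
      rw [sum_filter, sum_filter, ← (Equiv.optionSubtypeNe i).sum_comp, Fintype.sum_option]
      simp [hi]
    refine ⟨?_, central⟩
    by_cases h : ∀ i, Odd (N i)
    · exact almostCentral_torus_of_odd h3 h (by simpa [h] using hsum)
    · obtain ⟨i, hi⟩ := not_forall.1 h
      exact ⟨_, fun _ => Or.inr (Or.inl rfl), central i (Nat.not_odd_iff_even.1 hi)⟩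

/-! ### The graph polynomial and its coefficients -/

section Polynomial

variable {E V : Type*} [Fintype E]

theorem coeff_prod_sub [DecidableEq E] [DecidableEq V] (h t : E → V) (d : V →₀ ℕ) :
    (∏ e, (MvPolynomial.X (h e) - MvPolynomial.X (t e)) : MvPolynomial V ℝ).coeff d =
      orientCoeff h t fun v => d v := by
  classical
  have h1 : ∀ e, (MvPolynomial.X (h e) - MvPolynomial.X (t e) : MvPolynomial V ℝ) =
      ∑ b : Bool, MvPolynomial.monomial (Finsupp.single (if b then h e else t e) 1)
        (if b then 1 else -1) := fun e => by
    simp [MvPolynomial.X, sub_eq_add_neg]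
  simp_rw [h1]
  rw [Fintype.prod_sum, MvPolynomial.coeff_sum]
  unfold orientCoeff
  push_cast
  refine sum_congr rfl fun T _ => ?_
  rw [← MvPolynomial.monomial_sum_prod, MvPolynomial.coeff_monomial]
  have h2 : (∑ e, Finsupp.single (if T e then h e else t e) 1) = d ↔
      outDeg h t T = fun v => (d v : ℤ) := by
    rw [Finsupp.ext_iff, funext_iff]
    refine forall_congr' fun v => ?_
    rw [← Int.natCast_inj (m := (∑ e, Finsupp.single (if T e then h e else t e) 1) v)]
    simp [outDeg, Finsupp.finsetSum_apply, Finsupp.single_apply]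
  by_cases hT : outDeg h t T = fun v => (d v : ℤ)
  · rw [if_pos (h2.2 hT), if_pos hT]
    simp [choiceSign]
  · rw [if_neg (h2.not.2 hT), if_neg hT]

variable [DecidableEq V] [Fintype V] {G : SimpleGraph V} {h t : E → V}

/-- The graph polynomial, up to sign, in terms of a parametrization of the edges. -/
theorem exists_graphPolynomial_eq (hinj : Function.Injective fun e => s(h e, t e))
    (hmem : ∀ x, x ∈ G.edgeSet ↔ ∃ e, s(h e, t e) = x) :
    ∃ c : ℝ, c ≠ 0 ∧ G.graphPolynomial =
      MvPolynomial.C c * ∏ e, (MvPolynomial.X (h e) - MvPolynomial.X (t e)) := by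
  classical
  have h1 : ∀ e, ∃ ε : ℝ, ε ≠ 0 ∧ (MvPolynomial.X (Quot.out s(h e, t e)).2 -
      MvPolynomial.X (Quot.out s(h e, t e)).1 : MvPolynomial V ℝ) =
      MvPolynomial.C ε * (MvPolynomial.X (h e) - MvPolynomial.X (t e)) := fun e => by
    have h2 : s((Quot.out s(h e, t e)).1, (Quot.out s(h e, t e)).2) = s(h e, t e) :=
      Quot.out_eq _
    rcases Sym2.eq_iff.1 h2 with ⟨h3, h4⟩ | ⟨h3, h4⟩
    · exact ⟨-1, by norm_num, by rw [h3, h4]; simp⟩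
    · exact ⟨1, one_ne_zero, by rw [h3, h4]; simp⟩
  choose ε hε hε' using h1
  refine ⟨∏ e, ε e, prod_ne_zero_iff.2 fun e _ => hε e, ?_⟩
  rw [map_prod, ← prod_mul_distrib]
  unfold SimpleGraph.graphPolynomial
  have h2 : G.edgeFinset = univ.image fun e => s(h e, t e) := by
    ext x
    simp [SimpleGraph.mem_edgeFinset, hmem]
  rw [h2, prod_image hinj.injOn]
  exact prod_congr rfl fun e _ => hε' e

theorem coeff_graphPolynomial_ne_zero_iff [DecidableEq E] (hinj : Function.Injective fun e => s(h e, t e))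
    (hmem : ∀ x, x ∈ G.edgeSet ↔ ∃ e, s(h e, t e) = x) (d : V →₀ ℕ) :
    G.graphPolynomial.coeff d ≠ 0 ↔ orientCoeff h t (fun v => d v) ≠ 0 := by
  obtain ⟨c, hc, h1⟩ := exists_graphPolynomial_eq hinj hmem
  rw [h1, MvPolynomial.coeff_C_mul, coeff_prod_sub]
  simp [hc]

/-- The Alon-Tarsi number of a graph with a balanced orientation whose central coefficient is
non-zero. -/
theorem alonTarsiNumber_eq [DecidableEq E] [Nonempty V] (hinj : Function.Injective fun e => s(h e, t e))
    (hmem : ∀ x, x ∈ G.edgeSet ↔ ∃ e, s(h e, t e) = x) {n : ℕ} (hb : IsBalanced h t n)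
    (hn : orientCoeff h t (fun _ => (n : ℤ)) ≠ 0) : G.alonTarsiNumber = n + 1 := by
  unfold SimpleGraph.alonTarsiNumber
  apply le_antisymm
  · refine (iInf₂_le (n + 1) ⟨Finsupp.equivFunOnFinite.symm fun _ => n, ?_, ?_⟩).trans (by simp)
    · simp [sup_const univ_nonempty]
    · rw [coeff_graphPolynomial_ne_zero_iff hinj hmem]
      simpa using hn
  -- The largest exponent is at least the average exponent, which is `n`.
  · refine le_iInf₂ ?_
    rintro _ ⟨d, rfl, hd⟩
    rw [coeff_graphPolynomial_ne_zero_iff hinj hmem] at hd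
    have h1 := sum_of_orientCoeff_ne_zero hd
    rw [hb.card_eq] at h1
    have h2 : ∑ v, (d v : ℤ) ≤ ∑ _v : V, ((univ.sup fun v => d v : ℕ) : ℤ) :=
      sum_le_sum fun v _ => by exact_mod_cast le_sup (f := fun v => d v) (mem_univ v)
    rw [h1, sum_const, card_univ, nsmul_eq_mul, mul_comm] at h2
    have h3 := le_of_mul_le_mul_left h2 (by exact_mod_cast Fintype.card_pos)
    exact_mod_cast Nat.add_le_add_right (by exact_mod_cast h3) 1

end Polynomial

/-- The Alon-Tarsi theorem. -/
theorem listChromaticNumber_le_alonTarsiNumber {V : Type*} [Fintype V] (G : SimpleGraph V) :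
    G.listChromaticNumber ≤ G.alonTarsiNumber := by
  classical
  refine le_iInf₂ ?_
  rintro _ ⟨d, rfl, hd⟩
  refine iInf₂_le _ ?_
  intro A hA
  have hhom : G.graphPolynomial.IsHomogeneous (∑ _e ∈ G.edgeFinset, 1) :=
    MvPolynomial.IsHomogeneous.prod _ _ _ fun e _ =>
      (MvPolynomial.isHomogeneous_X _ _).sub (MvPolynomial.isHomogeneous_X _ _)
  have h0 : G.graphPolynomial ≠ 0 := fun h => hd (by rw [h, MvPolynomial.coeff_zero])
  -- By homogeneity every monomial that occurs has top degree, as the Nullstellensatz requires.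
  have hdeg : G.graphPolynomial.totalDegree = d.degree := by
    rw [hhom.totalDegree h0, ← hhom hd, Finsupp.degree_eq_weight_one]
    rfl
  obtain ⟨x, hx, hne⟩ := MvPolynomial.combinatorial_nullstellensatz_exists_eval_nonzero
    G.graphPolynomial d hd hdeg A fun v =>
      (Nat.lt_succ_of_le (le_sup (f := fun v => d v) (mem_univ v))).trans_le (hA v)
  refine ⟨⟨x, fun {u v} huv heq => hne ?_⟩, hx⟩
  rw [SimpleGraph.graphPolynomial, map_prod]
  refine prod_eq_zero (SimpleGraph.mem_edgeFinset.2 (G.mem_edgeSet.2 huv)) ?_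
  have h2 : s((Quot.out s(u, v)).1, (Quot.out s(u, v)).2) = s(u, v) := Quot.out_eq _
  rcases Sym2.eq_iff.1 h2 with ⟨h3, h4⟩ | ⟨h3, h4⟩ <;> rw [h3, h4] <;> simp_all

/-! ### Edges of the Cartesian product of cycles -/

section TorusGraph

theorem cycleGraph_adj_iff {n : ℕ} (hn : 2 ≤ n) (a b : Fin n) :
    (SimpleGraph.cycleGraph n).Adj a b ↔ a = finRotate n b ∨ b = finRotate n a := by
  obtain ⟨n, rfl⟩ := Nat.exists_eq_add_of_le' hn
  rw [SimpleGraph.cycleGraph_adj, finRotate_apply, finRotate_apply, sub_eq_iff_eq_add',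
    sub_eq_iff_eq_add']

theorem finRotate_ne_self {n : ℕ} (hn : 2 ≤ n) (a : Fin n) : finRotate n a ≠ a := by
  intro h
  have h1 := val_finRotate a
  rw [h] at h1
  split at h1 <;> omega

theorem finRotate_finRotate_ne_self {n : ℕ} (hn : 3 ≤ n) (a : Fin n) :
    finRotate n (finRotate n a) ≠ a := by
  intro h
  have h1 := val_finRotate a
  have h2 := val_finRotate (finRotate n a)
  rw [h] at h2
  split at h1 <;> split at h2 <;> omega

variable {ι : Type*} [DecidableEq ι] {N : ι → ℕ}

/-- Two steps traversing the same edge in opposite senses would form a closed walk of length two in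
one cycle, which length at least `3` excludes. -/
theorem torusEdge_injective (h3 : ∀ i, 3 ≤ N i) :
    Function.Injective fun e => s(torusHead N e, torusTail N e) := by
  rintro ⟨i, u⟩ ⟨j, v⟩ h
  have hrot := fun i => finRotate_ne_self (n := N i) (by have := h3 i; omega)
  rcases Sym2.eq_iff.1 h with ⟨h1, h2⟩ | ⟨h1, h2⟩
  · obtain rfl : u = v := h2
    by_cases hij : i = j
    · rw [hij]
    · have h4 := congr_fun h1 i
      rw [torusHead_of_ne N (j, u) hij, torusHead, shift_apply, Function.update_self] at h4
      exact absurd h4 (hrot i _)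
  · have h4 : finRotate _ (u i) = v i := by
      rw [← show torusHead N (i, u) i = v i from congr_fun h1 i, torusHead, shift_apply,
        Function.update_self]
    have h5 : u i = torusHead N (j, v) i := congr_fun h2 i
    by_cases hij : i = j
    · subst hij
      rw [torusHead, shift_apply, Function.update_self] at h5
      change u i = finRotate _ (v i) at h5
      rw [← h4] at h5
      exact absurd h5.symm (finRotate_finRotate_ne_self (h3 i) _)
    · rw [torusHead_of_ne N (j, v) hij] at h5
      exact absurd (h4.trans h5.symm) (hrot i _)

theorem eq_shift_iff (i : ι) (u v : ∀ i, Fin (N i)) :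
    u = shift N i v ↔ u i = finRotate _ (v i) ∧ ∀ j, j ≠ i → u j = v j := by
  rw [shift_apply, Function.eq_update_iff]

theorem mem_edgeSet_cartesianProduct (h3 : ∀ i, 3 ≤ N i) (x : Sym2 (∀ i, Fin (N i))) :
    x ∈ (SimpleGraph.cartesianProduct fun i => SimpleGraph.cycleGraph (N i)).edgeSet ↔
      ∃ e, s(torusHead N e, torusTail N e) = x := by
  induction x using Sym2.ind with
  | _ u v =>
    rw [SimpleGraph.mem_edgeSet, Prod.exists]
    refine exists_congr fun i => ?_
    rw [cycleGraph_adj_iff (by have := h3 i; omega)]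
    simp only [Sym2.eq_iff, torusHead, torusTail]
    constructor
    · rintro ⟨h | h, h'⟩
      · exact ⟨v, Or.inl ⟨((eq_shift_iff i u v).2 ⟨h, h'⟩).symm, rfl⟩⟩
      · exact ⟨u, Or.inr ⟨((eq_shift_iff i v u).2 ⟨h, fun j hj => (h' j hj).symm⟩).symm, rfl⟩⟩
    · rintro ⟨w, ⟨h, rfl⟩ | ⟨h, rfl⟩⟩
      · obtain ⟨h1, h2⟩ := (eq_shift_iff i u w).1 h.symm
        exact ⟨Or.inl h1, h2⟩
      · obtain ⟨h1, h2⟩ := (eq_shift_iff i v w).1 h.symm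
        exact ⟨Or.inr h1, fun j hj => (h2 j hj).symm⟩

end TorusGraph

end AlonTarsi

theorem mainTheorem3 (n m : ℕ) (hmn : m < n) (k : Fin n → ℕ)
    (hodd : ∀ i : Fin n, (i : ℕ) < m → 1 ≤ k i)
    (heven : ∀ i : Fin n, m ≤ (i : ℕ) → 2 ≤ k i)
    (hsum : ∑ i ∈ Finset.univ.filter (fun i : Fin n => (i : ℕ) < m), 1 / (k i : ℝ) ≤ 1)
    (G : SimpleGraph (∀ i : Fin n, Fin (if (i : ℕ) < m then 2 * k i + 1 else 2 * k i)))
    (hG : G = SimpleGraph.cartesianProduct fun i : Fin n =>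
      SimpleGraph.cycleGraph (if (i : ℕ) < m then 2 * k i + 1 else 2 * k i)) :
    G.listChromaticNumber ≤ G.alonTarsiNumber ∧ G.alonTarsiNumber = n + 1 := by
  refine ⟨AlonTarsi.listChromaticNumber_le_alonTarsiNumber G, ?_⟩
  subst hG
  set N : Fin n → ℕ := fun i => if (i : ℕ) < m then 2 * k i + 1 else 2 * k i with hN
  have h3 : ∀ i, 3 ≤ N i := fun i => by
    have h1 := hodd i
    have h2 := heven i
    simp only [hN]
    split <;> omega
  have hpar : ∀ i, Odd (N i) ↔ (i : ℕ) < m := fun i => by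
    simp only [hN]
    split <;> simp [*]
  have hsum' : ∑ i with Odd (N i), 2 / (N i : ℝ) ≤ 1 := by
    simp_rw [hpar]
    -- Termwise `2 / (2 * k + 1) ≤ 1 / k`.
    refine (Finset.sum_le_sum fun i hi => ?_).trans hsum
    have hi : (i : ℕ) < m := (Finset.mem_filter.1 hi).2
    have hk : (1 : ℝ) ≤ k i := by exact_mod_cast hodd i hi
    simp only [hN, if_pos hi]
    rw [div_le_div_iff₀ (by positivity) (by linarith)]
    push_cast
    linarith
  have hev : Even (N ⟨m, hmn⟩) := by
    rw [← Nat.not_odd_iff_even, hpar]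
    exact lt_irrefl m
  have : Nonempty (∀ i, Fin (N i)) := ⟨fun i => ⟨0, by have := h3 i; omega⟩⟩
  have h := (AlonTarsi.almostCentral_torus N h3 hsum').2 _ hev
  have hb := AlonTarsi.isBalanced_torus N
  rw [Fintype.card_fin] at h hb
  exact AlonTarsi.alonTarsiNumber_eq (AlonTarsi.torusEdge_injective h3)
    (AlonTarsi.mem_edgeSet_cartesianProduct h3) hb h
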